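/- Let $0<\varepsilon<1/2$ and let $(\xi_i,Y_i)$, $i=1,2,\dots$, be independent and identically distributed pairs of real random variables on a probability space $(\Omega,\mathcal F,\mathbb P)$ ($Y_i$ may depend on $\xi_i$) such that $\mathbb P[\varepsilon\le\xi_1\le 1-\varepsilon]=1$ and the $Y_i$ take values in $[-1,1]$. Let $\chi:[0,\infty)\to[0,\infty)$ be any function with $\lim_{x\to\infty}\chi(x)=0$. For $n\ge1$ let $p_n$ be $\xi_n+Y_n\chi(n)$ truncated to $[\varepsilon/2,1-\varepsilon/2]$, that is, $p_n=\min\{\max\{\xi_n+Y_n\chi(n),\varepsilon/2\},1-\varepsilon/2\}$, and let $q_n=1-p_n$. For a fixed realization $\omega$ of these variables (the environment), let $(\eta_t(\omega))_{t\ge0}$ be the Markov chain on $\{0,1,2,\dots\}$ that jumps from $n\ge1$ to $n-1$ with probability $p_n$ and to $n+1$ with probability $q_n$, and from $0$ to each of $0$ and $1$ with probability $1/2$. Put $\zeta_1=\log\bigl(\xi_1/(1-\xi_1)\bigr)$ and $\sigma^2=\operatorname{Var}[\zeta_1]$. Suppose that $Y_1/\xi_1$ and $-Y_1/(1-\xi_1)$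 have the same distribution, $\mathbb P[Y_1=0]<1$, $\mathbb E[\zeta_1]=0$ and $\sigma^2>0$. Then, for $\mathbb P$-almost every $\omega$, the chain $\eta_t(\omega)$ is null-recurrent: started from any state, it returns to that state with probability one, and the mean return time is infinite. -/

import Mathlib

open MeasureTheory ProbabilityTheory Filter Topology
open scoped NNReal ENNReal

noncomputable section

namespace PerturbedRWRE

/-! ### The random environment -/

/-- The number `x` truncated to the interval `[ε/2, 1 - ε/2]`. -/
def truncate (ε x : ℝ) : ℝ :=
  if x < ε / 2 then ε / 2 else if 1 - ε / 2 < x then 1 - ε / 2 else x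

theorem truncate_mem_unitInterval {ε : ℝ} (hε : 0 < ε ∧ ε < 1 / 2) (x : ℝ) :
    truncate ε x ∈ unitInterval := by
  unfold truncate
  split_ifs <;> constructor <;> linarith [hε.1, hε.2]

/-- The environment at one realization: `x n`, `y n` are the values of `ξ_n`, `Y_n`, and
`environment hε χ x y n` is `p_n`, that is, `ξ_n + Y_n χ(n)` truncated to `[ε/2, 1 - ε/2]`. -/
def environment {ε : ℝ} (hε : 0 < ε ∧ ε < 1 / 2) (χ : ℝ≥0 → ℝ≥0) (x y : ℕ+ → ℝ) :
    ℕ+ → unitInterval :=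
  fun n => ⟨truncate ε (x n + y n * (χ (n : ℕ) : ℝ)), truncate_mem_unitInterval hε _⟩

/-! ### The nearest-neighbour walk in a fixed environment -/

/-- The law of one step of the walk: from `n ≥ 1` to `n - 1` with probability `p n` and to `n + 1`
with probability `1 - p n`; from `0` to `0` and to `1` with probability `1/2` each. -/
def stepLaw (p : ℕ+ → unitInterval) : ℕ → Measure ℕ
  | 0 => (2⁻¹ : ℝ≥0∞) • Measure.dirac 0 + (2⁻¹ : ℝ≥0∞) • Measure.dirac 1
  | n + 1 => ENNReal.ofReal (p n.succPNat) • Measure.dirac n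
      + ENNReal.ofReal (1 - p n.succPNat) • Measure.dirac (n + 2)

instance isProbabilityMeasure_stepLaw (p : ℕ+ → unitInterval) (n : ℕ) :
    IsProbabilityMeasure (stepLaw p n) := by
  constructor
  cases n with
  | zero => simp [stepLaw, ENNReal.inv_two_add_inv_two]
  | succ n =>
    have h := (p n.succPNat).2
    simp only [stepLaw, Measure.coe_add, Measure.coe_smul, Pi.add_apply, Pi.smul_apply,
      measure_univ, smul_eq_mul, mul_one]
    rw [← ENNReal.ofReal_add h.1 (by linarith [h.2])]
    simp

/-- The transition kernel of the walk in the environment `p`. -/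
def walkKernel (p : ℕ+ → unitInterval) : Kernel ℕ ℕ :=
  Kernel.ofFunOfCountable (stepLaw p)

instance isMarkovKernel_walkKernel (p : ℕ+ → unitInterval) : IsMarkovKernel (walkKernel p) :=
  ⟨fun n => isProbabilityMeasure_stepLaw p n⟩

/-! ### Time-homogeneous Markov chains on the nonnegative integers -/

/-- The law on path space of the Markov chain with transition kernel `κ` started at `r`: the next
state is drawn from `κ` at the current state. -/
def chainLaw (κ : Kernel ℕ ℕ) [IsMarkovKernel κ] (r : ℕ) : Measure (ℕ → ℕ) :=
  Kernel.traj (X := fun _ => ℕ)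
    (fun n => κ.comap (fun h : (Π _ : Finset.Iic n, ℕ) => h ⟨n, Finset.mem_Iic.2 le_rfl⟩)
      (measurable_pi_apply _)) 0 (fun _ => r)

/-- The first time `t ≥ 1` at which the path is in state `x` (`∞` if there is none). -/
def hitTime (x : ℕ) (path : ℕ → ℕ) : ℝ≥0∞ :=
  ⨅ (t : ℕ) (_ : 1 ≤ t ∧ path t = x), (t : ℝ≥0∞)

/-- A state is recurrent if the chain started there almost surely returns to it. -/
def IsRecurrentState (κ : Kernel ℕ ℕ) [IsMarkovKernel κ] (x : ℕ) : Prop :=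
  ∀ᵐ path ∂(chainLaw κ x), ∃ t : ℕ, 1 ≤ t ∧ path t = x

/-- A chain is null-recurrent if each of its states is recurrent with infinite mean return time. -/
def IsNullRecurrent (κ : Kernel ℕ ℕ) [IsMarkovKernel κ] : Prop :=
  ∀ x : ℕ, IsRecurrentState κ x ∧ ∫⁻ path, hitTime x path ∂(chainLaw κ x) = ∞

end PerturbedRWRE

end

namespace PerturbedRWRE

/-! ### Path measures and the first-step decomposition -/

/-! In a fixed environment everything is governed by the potential `S_n = ∑_{i ≤ n} log (p_i / (1 -
p_i))`. Increments of harmonic functions are proportional to `exp S_n`, so a potential unbounded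
above leaves no nonzero bounded harmonic function vanishing at a state, and hence no escape. If `S`
is also unbounded below, the mean hitting time equation has no nonnegative solution, so mean return
times are infinite (`isNullRecurrent_walkKernel`).

It remains to show that `S` almost surely oscillates without bound in both directions. Once `χ(n) ≤
ε/2` the truncation is inactive and the `n`-th log odds equal `ζ_n + log (1 + χ(n) Y_n/ξ_n) - log (1
- χ(n) Y_n/(1 - ξ_n))`. By the symmetry hypothesis the two logarithms have the same law, so the mean
is exactly zero, however slowly `χ` decays (`integral_logOdds_truncate_eq_zero`). Up to a bounded
correction, `S` is therefore a martingale with bounded increments, which either converges or is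
unbounded on both sides. It cannot converge: its increments are asymptotic to the nondegenerate
i.i.d. `ζ_n` and so do not tend to zero (`ae_frequently_lt_sum`). -/

/-- Countability of the state space reduces marginals on initial segments to singletons; these
marginals determine all finite-dimensional ones, and projective limits are unique. -/
theorem measure_path_ext {μ ν : Measure (ℕ → ℕ)} [IsFiniteMeasure μ] [IsFiniteMeasure ν]
    (h : ∀ (w : ℕ → ℕ) (n : ℕ), μ {path | ∀ i ≤ n, path i = w i} = ν {path | ∀ i ≤ n, path i = w i}) :
    μ = ν := by
  have hmap : ∀ n : ℕ, μ.map (Preorder.frestrictLe (π := fun _ : ℕ => ℕ) n)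
      = ν.map (Preorder.frestrictLe (π := fun _ : ℕ => ℕ) n) := by
    intro n
    refine Measure.ext_of_singleton fun v => ?_
    have hpre : (Preorder.frestrictLe (π := fun _ : ℕ => ℕ) n) ⁻¹' {v}
        = {path | ∀ i ≤ n, path i = if hi : i ≤ n then v ⟨i, Finset.mem_Iic.2 hi⟩ else 0} := by
      ext path
      simp only [Set.mem_preimage, Set.mem_singleton_iff, Set.mem_ofPred_eq]
      constructor
      · rintro rfl i hi
        simp [hi]
      · intro hp
        funext ⟨i, hi⟩
        have := hp i (Finset.mem_Iic.1 hi)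
        simpa [Finset.mem_Iic.1 hi] using this
    rw [Measure.map_apply (by fun_prop) (measurableSet_singleton _),
      Measure.map_apply (by fun_prop) (measurableSet_singleton _), hpre, h]
  have hμ : IsProjectiveLimit (α := fun _ : ℕ => ℕ) μ fun I : Finset ℕ => μ.map I.restrict :=
    fun _ => rfl
  refine hμ.unique fun I => ?_
  obtain ⟨N, hN⟩ : ∃ N, I ⊆ Finset.Iic N :=
    ⟨I.sup id, fun i hi => Finset.mem_Iic.2 (Finset.le_sup (f := id) hi)⟩
  have hcomp : I.restrict (π := fun _ : ℕ => ℕ)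
      = Finset.restrict₂ (π := fun _ : ℕ => ℕ) hN ∘ Preorder.frestrictLe (π := fun _ : ℕ => ℕ) N := rfl
  change ν.map (I.restrict (π := fun _ : ℕ => ℕ)) = μ.map (I.restrict (π := fun _ : ℕ => ℕ))
  rw [hcomp, ← Measure.map_map (by fun_prop) (by fun_prop),
    ← Measure.map_map (by fun_prop) (by fun_prop), hmap]

theorem measurableSet_path_cylinder (w : ℕ → ℕ) (n : ℕ) :
    MeasurableSet {path : ℕ → ℕ | ∀ i ≤ n, path i = w i} := by
  have : {path : ℕ → ℕ | ∀ i ≤ n, path i = w i} = ⋂ i ≤ n, (fun path => path i) ⁻¹' {w i} := by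
    ext; simp
  rw [this]
  exact MeasurableSet.biInter (Set.to_countable _)
    fun i _ => measurable_pi_apply i (measurableSet_singleton _)

section Chain

variable (κ : Kernel ℕ ℕ) [IsMarkovKernel κ]

instance isProbabilityMeasure_chainLaw (y : ℕ) : IsProbabilityMeasure (chainLaw κ y) := by
  unfold chainLaw; infer_instance

theorem chainLaw_map_zero (y : ℕ) : (chainLaw κ y).map (fun path => path 0) = Measure.dirac y := by
  have hf : (fun path : ℕ → ℕ => path 0)
      = (fun v : (Π _ : Finset.Iic 0, ℕ) => v ⟨0, Finset.mem_Iic.2 le_rfl⟩)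
        ∘ Preorder.frestrictLe (π := fun _ : ℕ => ℕ) 0 := rfl
  rw [hf, ← Measure.map_map (by fun_prop) (by fun_prop), chainLaw,
    Kernel.traj_map_frestrictLe_apply, Kernel.partialTraj_self, Kernel.id_apply]
  exact Measure.map_dirac' (measurable_pi_apply _) _

theorem chainLaw_ae_zero (y : ℕ) : ∀ᵐ path ∂(chainLaw κ y), path 0 = y := by
  have : ∀ᵐ a ∂((chainLaw κ y).map fun path => path 0), a = y := by
    rw [chainLaw_map_zero]; simp
  exact ae_of_ae_map (measurable_pi_apply 0).aemeasurable this

theorem chainLaw_cylinder (y : ℕ) (w : ℕ → ℕ) (n : ℕ) :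
    chainLaw κ y {path | ∀ i ≤ n, path i = w i}
      = (Measure.dirac y {w 0}) * ∏ i ∈ Finset.range n, κ (w i) {w (i + 1)} := by
  induction n with
  | zero =>
    rw [← chainLaw_map_zero κ y, Measure.map_apply (by fun_prop) (measurableSet_singleton _)]
    simp [Set.preimage]
  | succ n ih =>
    rw [Finset.prod_range_succ, ← mul_assoc, ← ih]
    set v : (Π _ : Finset.Iic n, ℕ) := fun i => w i with hv
    have hA : {path : ℕ → ℕ | ∀ i ≤ n, path i = w i}
        = Preorder.frestrictLe (π := fun _ : ℕ => ℕ) n ⁻¹' {v} := by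
      ext path
      simp [hv, funext_iff]
    have hB : {path : ℕ → ℕ | ∀ i ≤ n + 1, path i = w i}
        = (fun path : ℕ → ℕ => (Preorder.frestrictLe (π := fun _ : ℕ => ℕ) n path, path (n + 1)))
          ⁻¹' ({v} ×ˢ {w (n + 1)}) := by
      ext path
      simp only [Set.mem_ofPred_eq, Set.mem_preimage, Set.mem_prod, Set.mem_singleton_iff, hv,
        funext_iff, Nat.le_succ_iff]
      constructor
      · exact fun h => ⟨fun i => h i (Or.inl (Finset.mem_Iic.1 i.2)), h _ (Or.inr rfl)⟩
      · rintro ⟨h1, h2⟩ i (hi | rfl)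
        · exact h1 ⟨i, Finset.mem_Iic.2 hi⟩
        · exact h2
    rw [hA, hB, ← Measure.map_apply (by fun_prop) (measurableSet_singleton _),
      ← Measure.map_apply (by fun_prop) ((measurableSet_singleton _).prod (measurableSet_singleton _))]
    unfold chainLaw
    rw [← Kernel.partialTraj_compProd_eq_map_traj (zero_le),
      Measure.compProd_apply_prod (measurableSet_singleton _) (measurableSet_singleton _),
      Kernel.traj_map_frestrictLe_apply]
    simp [hv, mul_comm]

/-- The path seen after its first step. -/
def shiftPath (path : ℕ → ℕ) : ℕ → ℕ := fun t => path (t + 1)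

@[fun_prop]
theorem measurable_shiftPath : Measurable shiftPath :=
  measurable_pi_lambda _ fun t => measurable_pi_apply (t + 1)

/-- The Markov property at time one, checked on cylinders; every first-step equation below comes
from it. -/
theorem chainLaw_map_shiftPath (y : ℕ) :
    (chainLaw κ y).map shiftPath = (κ y).bind (chainLaw κ) := by
  have hm : Measurable (chainLaw κ) := measurable_from_nat
  have : IsProbabilityMeasure ((chainLaw κ y).map shiftPath) :=
    Measure.isProbabilityMeasure_map (by fun_prop)
  have : IsProbabilityMeasure ((κ y).bind (chainLaw κ)) :=
    isProbabilityMeasure_bind hm.aemeasurable (.of_forall fun _ => inferInstance)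
  refine measure_path_ext fun w n => ?_
  have hw := measurableSet_path_cylinder w n
  rw [Measure.map_apply (by fun_prop) hw, Measure.bind_apply hw hm.aemeasurable]
  -- Prepending the almost sure starting point `y` turns a shifted cylinder into an ordinary one.
  set w' : ℕ → ℕ := fun t => Nat.casesOn t y w with hw'
  have hset : chainLaw κ y (shiftPath ⁻¹' {path | ∀ i ≤ n, path i = w i})
      = chainLaw κ y {path | ∀ i ≤ n + 1, path i = w' i} := by
    refine measure_congr ?_
    filter_upwards [chainLaw_ae_zero κ y] with path hpath
    refine propext ?_
    change (∀ i ≤ n, path (i + 1) = w i) ↔ ∀ i ≤ n + 1, path i = w' i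
    constructor
    · rintro h (_ | i) hi
      · exact hpath
      · exact h i (by omega)
    · exact fun h i hi => h (i + 1) (by omega)
  rw [hset, chainLaw_cylinder, Finset.prod_range_succ']
  simp_rw [chainLaw_cylinder]
  rw [lintegral_mul_const _ measurable_from_nat]
  have : ∫⁻ a, Measure.dirac a {w 0} ∂(κ y) = κ y {w 0} := by
    rw [← lintegral_indicator_one (measurableSet_singleton _)]
    refine lintegral_congr fun a => ?_
    simp [Set.indicator]
  rw [this]
  simp [hw', mul_comm]

theorem lintegral_comp_shiftPath (y : ℕ) {f : (ℕ → ℕ) → ℝ≥0∞} (hf : Measurable f) :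
    ∫⁻ path, f (shiftPath path) ∂(chainLaw κ y)
      = ∫⁻ z, ∫⁻ path, f path ∂(chainLaw κ z) ∂(κ y) := by
  rw [← lintegral_map hf measurable_shiftPath, chainLaw_map_shiftPath,
    Measure.lintegral_bind measurable_from_nat.aemeasurable hf.aemeasurable]

/-! ### Escape probability and mean hitting time -/

/-- The probability that the chain started at `y` does not visit `x` at any time `t ≥ 1`. -/
noncomputable def escapeProb (x y : ℕ) : ℝ≥0∞ := chainLaw κ y {path | ∀ t, 1 ≤ t → path t ≠ x}

theorem measurableSet_avoid (x s : ℕ) :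
    MeasurableSet {path : ℕ → ℕ | ∀ t, s ≤ t → path t ≠ x} := by
  have : {path : ℕ → ℕ | ∀ t, s ≤ t → path t ≠ x} = ⋂ t, ⋂ (_ : s ≤ t), (fun path => path t) ⁻¹' {x}ᶜ := by
    ext; simp
  rw [this]
  exact MeasurableSet.iInter fun t => MeasurableSet.iInter fun _ =>
    measurable_pi_apply t (measurableSet_singleton _).compl

/-- After one step the path must avoid `x` from time `0` on: impossible from `x` itself, and the
same as avoiding it from time `1` on from elsewhere. -/
theorem escapeProb_eq_lintegral (x y : ℕ) :
    escapeProb κ x y = ∫⁻ z, (if z = x then 0 else escapeProb κ x z) ∂(κ y) := by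
  have hA := measurableSet_avoid x 0
  have h := lintegral_comp_shiftPath κ y
    (f := {path : ℕ → ℕ | ∀ t, 0 ≤ t → path t ≠ x}.indicator 1) (measurable_one.indicator hA)
  simp_rw [lintegral_indicator_one hA] at h
  have h1 : ∫⁻ path, {path : ℕ → ℕ | ∀ t, 0 ≤ t → path t ≠ x}.indicator 1 (shiftPath path)
      ∂(chainLaw κ y) = escapeProb κ x y := by
    rw [escapeProb, ← lintegral_indicator_one (measurableSet_avoid x 1)]
    refine lintegral_congr fun path => ?_
    have : shiftPath path ∈ {path : ℕ → ℕ | ∀ t, 0 ≤ t → path t ≠ x}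
        ↔ path ∈ {path : ℕ → ℕ | ∀ t, 1 ≤ t → path t ≠ x} := by
      constructor
      · rintro h (_ | t) ht
        · omega
        · exact h t (Nat.zero_le _)
      · exact fun h t _ => h (t + 1) (by omega)
    simp only [Set.indicator, Pi.one_apply]
    by_cases hp : path ∈ {path : ℕ → ℕ | ∀ t, 1 ≤ t → path t ≠ x}
    · rw [if_pos hp, if_pos (this.2 hp)]
    · rw [if_neg hp, if_neg fun h => hp (this.1 h)]
  rw [← h1, h]
  refine lintegral_congr fun z => ?_
  split_ifs with hz
  · rw [← nonpos_iff_eq_zero, ← ae_iff.1 (chainLaw_ae_zero κ z)]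
    exact measure_mono fun path hp h0 => hp 0 le_rfl (h0.trans hz)
  · refine measure_congr ?_
    filter_upwards [chainLaw_ae_zero κ z] with path h0
    refine propext ?_
    change (∀ t, 0 ≤ t → path t ≠ x) ↔ ∀ t, 1 ≤ t → path t ≠ x
    constructor
    · exact fun h t _ => h t (Nat.zero_le _)
    · rintro h (_ | t) _
      · exact h0 ▸ hz
      · exact h _ (by omega)

/-- The mean time at which the chain started at `y` first visits `x` after time `0`. -/
noncomputable def meanHitTime (x y : ℕ) : ℝ≥0∞ := ∫⁻ path, hitTime x path ∂(chainLaw κ y)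

/-- The first time `t ≥ 0` at which the path is in state `x`. -/
noncomputable def entranceTime (x : ℕ) (path : ℕ → ℕ) : ℝ≥0∞ :=
  ⨅ (t : ℕ) (_ : path t = x), (t : ℝ≥0∞)

theorem measurable_entranceTime (x : ℕ) : Measurable (entranceTime x) := by
  unfold entranceTime
  refine Measurable.iInf fun t => ?_
  have : (fun path : ℕ → ℕ => ⨅ (_ : path t = x), (t : ℝ≥0∞))
      = (fun a : ℕ => ⨅ (_ : a = x), (t : ℝ≥0∞)) ∘ fun path => path t := rfl
  rw [this]
  exact measurable_from_nat.comp (measurable_pi_apply t)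

theorem hitTime_eq (x : ℕ) (path : ℕ → ℕ) :
    hitTime x path = 1 + entranceTime x (shiftPath path) := by
  unfold hitTime entranceTime shiftPath
  simp_rw [ENNReal.add_iInf]
  refine le_antisymm (le_iInf₂ fun t ht => ?_) (le_iInf₂ fun t ht => ?_)
  · refine (iInf₂_le (t + 1) ⟨by omega, ht⟩).trans_eq ?_
    push_cast; ring
  · obtain ⟨t, rfl⟩ : ∃ s, t = s + 1 := ⟨t - 1, by omega⟩
    refine (iInf₂_le t ht.2).trans_eq ?_
    push_cast; ring

theorem meanHitTime_eq_lintegral (x y : ℕ) :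
    meanHitTime κ x y = 1 + ∫⁻ z, (if z = x then 0 else meanHitTime κ x z) ∂(κ y) := by
  unfold meanHitTime
  simp_rw [hitTime_eq]
  rw [lintegral_add_left measurable_const,
    lintegral_comp_shiftPath κ y (measurable_entranceTime x)]
  simp only [lintegral_const, measure_univ, mul_one]
  congr 1
  refine lintegral_congr fun z => ?_
  split_ifs with hz
  · rw [lintegral_eq_zero_iff (measurable_entranceTime x)]
    filter_upwards [chainLaw_ae_zero κ z] with path h0
    simpa [entranceTime] using (iInf₂_le (f := fun (t : ℕ) (_ : path t = x) => (t : ℝ≥0∞)) 0 (h0.trans hz))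
  · refine lintegral_congr_ae ?_
    filter_upwards [chainLaw_ae_zero κ z] with path h0
    rw [← hitTime_eq]
    refine le_antisymm (le_iInf₂ fun t ht => iInf₂_le t ht.2) (le_iInf₂ fun t ht => ?_)
    refine iInf₂_le t ⟨?_, ht⟩
    rcases t with _ | t
    · exact absurd (h0.symm.trans ht) hz
    · omega

end Chain

/-! ### Difference equations for harmonic functions and mean hitting times -/

section DifferenceEquations

variable {a W : ℕ → ℝ} (ha : ∀ m, 0 < a m ∧ a m < 1) (hWpos : ∀ m, 0 < W m)
  (hW : ∀ m, (1 - a m) * W (m + 1) = a m * W m) {f : ℕ → ℝ} {x : ℕ}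

include ha hW in
-- Here `a m` is the probability of stepping down from site `m + 1`. Harmonicity there multiplies
-- the increment by `a m / (1 - a m)`, which is also the ratio of consecutive values of `W`.
theorem increment_mul_eq (hf : ∀ m, x ≤ m → f (m + 1) = a m * f m + (1 - a m) * f (m + 2))
    {m : ℕ} (hm : x ≤ m) : (f (m + 1) - f m) * W x = (f (x + 1) - f x) * W m := by
  induction m, hm using Nat.le_induction with
  | base => rfl
  | succ m hm ih =>
    have h1 : (1 - a m) * (f (m + 2) - f (m + 1)) = a m * (f (m + 1) - f m) := by
      linear_combination -(hf m hm)
    refine mul_left_cancel₀ (sub_pos.2 (ha m).2).ne' ?_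
    linear_combination W x * h1 + a m * ih - (f (x + 1) - f x) * hW m

include ha hWpos hW in
theorem eq_zero_of_harmonic_above (hf : ∀ m, x ≤ m → f (m + 1) = a m * f m + (1 - a m) * f (m + 2))
    (hx : f x = 0) (hf0 : ∀ m, 0 ≤ f m) (hf1 : ∀ m, f m ≤ 1) (hWtop : ∀ C, ∃ᶠ m in atTop, C < W m)
    {m : ℕ} (hm : x ≤ m) : f m = 0 := by
  have key : f (x + 1) = 0 := by
    by_contra hne
    have hpos : 0 < f (x + 1) := lt_of_le_of_ne (hf0 _) (Ne.symm hne)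
    -- At such a `k` the increment of `f` exceeds `1`, which is impossible for values in `[0, 1]`.
    obtain ⟨k, hk, hxk⟩ :=
      ((hWtop (W x / f (x + 1))).and_eventually (eventually_ge_atTop x)).exists
    have h1 := increment_mul_eq ha hW hf hxk
    rw [div_lt_iff₀ hpos] at hk
    rw [hx, sub_zero] at h1
    nlinarith [hf0 k, hf1 (k + 1), hWpos x]
  induction m, hm using Nat.le_induction with
  | base => exact hx
  | succ m hm ih =>
    have h1 := increment_mul_eq ha hW hf hm
    rw [key, hx, sub_zero, zero_mul, ih, sub_zero] at h1
    exact (mul_eq_zero.1 h1).resolve_right (hWpos x).ne'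

include ha in
-- The condition at `0` makes the first increment vanish, and harmonicity propagates this up to `x`;
-- no growth of `W` is needed.
theorem eq_zero_of_harmonic_below
    (hf : ∀ m, m + 1 < x → f (m + 1) = a m * f m + (1 - a m) * f (m + 2))
    (h0 : 0 < x → f 0 = f 1) (hx : f x = 0) {m : ℕ} (hm : m ≤ x) : f m = 0 := by
  have hstep : ∀ m, m < x → f (m + 1) = f m := by
    intro m
    induction m with
    | zero => exact fun h => (h0 h).symm
    | succ m ih =>
      intro h
      have h1 := ih (by omega)
      refine mul_left_cancel₀ (sub_pos.2 (ha m).2).ne' ?_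
      linear_combination -(hf m h) + a m * h1
  induction hm using Nat.decreasingInduction with
  | self => exact hx
  | of_succ m hm ih => rw [← hstep m hm, ih]

include ha hWpos hW in
-- The increment divided by `W` drops by at least `1 / W` at each step. Since `1 / W` is unbounded,
-- it eventually stays below `-1`; then `f` falls by at least `W` per step, and `W` is unbounded
-- too.
theorem exists_neg_of_mean_hitting_equation
    (hf : ∀ m, x ≤ m → f (m + 1) = 1 + (a m * f m + (1 - a m) * f (m + 2)))
    (hWtop : ∀ C, ∃ᶠ m in atTop, C < W m) (hWbot : ∀ C, ∃ᶠ m in atTop, C < (W m)⁻¹) :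
    ∃ m, f m < 0 := by
  set g : ℕ → ℝ := fun m => (f (m + 1) - f m) / W m with hg
  have hgstep : ∀ m, x ≤ m → g (m + 1) ≤ g m - (W (m + 1))⁻¹ := by
    intro m hm
    have hq : 0 < 1 - a m := sub_pos.2 (ha m).2
    have e1 : (1 - a m) * (f (m + 2) - f (m + 1)) = a m * (f (m + 1) - f m) - 1 := by
      linear_combination -(hf m hm)
    have e2 : f (m + 1) - f m = g m * W m := by
      simp only [hg]; field_simp [(hWpos m).ne']
    have e3 : (1 - a m) * (f (m + 2) - f (m + 1)) = (1 - a m) * (g m * W (m + 1)) - 1 := by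
      rw [e1, e2]; linear_combination -(g m) * hW m
    have e4 : f (m + 2) - f (m + 1) ≤ g m * W (m + 1) - 1 := by
      have hle : 1 ≤ (1 - a m)⁻¹ := (one_le_inv₀ hq).2 (by linarith [(ha m).1])
      have : f (m + 2) - f (m + 1) = g m * W (m + 1) - (1 - a m)⁻¹ := by
        refine mul_left_cancel₀ hq.ne' ?_
        rw [e3, mul_sub, mul_inv_cancel₀ hq.ne']
      linarith
    calc g (m + 1) ≤ (g m * W (m + 1) - 1) / W (m + 1) :=
          div_le_div_of_nonneg_right e4 (hWpos _).le
      _ = g m - (W (m + 1))⁻¹ := by field_simp [(hWpos (m + 1)).ne']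
  have hganti : ∀ k m, x ≤ k → k ≤ m → g m ≤ g k := by
    intro k m hk hkm
    induction m, hkm using Nat.le_induction with
    | base => exact le_rfl
    | succ m hm ih =>
      linarith [hgstep m (hk.trans hm), inv_pos.2 (hWpos (m + 1))]
  obtain ⟨M, hM, hxM⟩ := ((hWbot (g x + 1)).and_eventually (eventually_ge_atTop (x + 1))).exists
  have hgM : g M ≤ -1 := by
    obtain ⟨k, rfl⟩ : ∃ k, M = k + 1 := ⟨M - 1, by omega⟩
    linarith [hgstep k (by omega), hganti x k le_rfl (by omega)]
  have hdec : ∀ m, M ≤ m → f (m + 1) ≤ f m - W m := by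
    intro m hm
    have h1 : g m ≤ -1 := (hganti M m (by omega) hm).trans hgM
    rw [hg, div_le_iff₀ (hWpos m)] at h1
    linarith
  have hfM : ∀ m, M ≤ m → f m ≤ f M := by
    intro m hm
    induction m, hm using Nat.le_induction with
    | base => exact le_rfl
    | succ m hm ih => linarith [hdec m hm, hWpos m]
  obtain ⟨m, hm, hMm⟩ := ((hWtop (f M)).and_eventually (eventually_ge_atTop M)).exists
  exact ⟨m + 1, by linarith [hdec m hMm, hfM m hMm]⟩

end DifferenceEquations

/-! ### Null recurrence of the walk in a fixed environment -/

/-- The potential of the environment: the sum of `log (p_i / (1 - p_i))` over `1 ≤ i ≤ n`. -/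
noncomputable def potential (p : ℕ+ → unitInterval) (n : ℕ) : ℝ :=
  ∑ i ∈ Finset.range n, Real.log ((p i.succPNat : ℝ) / (1 - p i.succPNat))

section FixedEnvironment

variable (p : ℕ+ → unitInterval)

theorem lintegral_walkKernel_zero (F : ℕ → ℝ≥0∞) :
    ∫⁻ z, F z ∂(walkKernel p 0) = 2⁻¹ * F 0 + 2⁻¹ * F 1 := by
  change ∫⁻ z, F z ∂(stepLaw p 0) = _
  simp [stepLaw, lintegral_add_measure]

theorem lintegral_walkKernel_succ (F : ℕ → ℝ≥0∞) (m : ℕ) :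
    ∫⁻ z, F z ∂(walkKernel p (m + 1))
      = ENNReal.ofReal (p m.succPNat) * F m + ENNReal.ofReal (1 - p m.succPNat) * F (m + 2) := by
  change ∫⁻ z, F z ∂(stepLaw p (m + 1)) = _
  simp [stepLaw, lintegral_add_measure]

variable {p} (hp : ∀ n, 0 < (p n : ℝ) ∧ (p n : ℝ) < 1)

include hp in
theorem exp_potential_succ (m : ℕ) :
    (1 - (p m.succPNat : ℝ)) * Real.exp (potential p (m + 1))
      = p m.succPNat * Real.exp (potential p m) := by
  have h1 := hp m.succPNat
  have h2 : 0 < 1 - (p m.succPNat : ℝ) := by linarith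
  rw [potential, Finset.sum_range_succ, Real.exp_add, Real.exp_log (div_pos h1.1 h2), ← potential]
  field_simp

theorem frequently_lt_exp {S : ℕ → ℝ} (h : ∀ C, ∃ᶠ m in atTop, C < S m) (C : ℝ) :
    ∃ᶠ m in atTop, C < Real.exp (S m) :=
  (h C).mono fun m hm => by linarith [Real.add_one_le_exp (S m)]

include hp in
theorem isRecurrentState_walkKernel (htop : ∀ C, ∃ᶠ m in atTop, C < potential p m) (x : ℕ) :
    IsRecurrentState (walkKernel p) x := by
  suffices h : escapeProb (walkKernel p) x x = 0 by
    rw [IsRecurrentState, ae_iff, ← h, escapeProb]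
    congr 1; ext path; simp
  -- Setting the value at `x` to `0` gives a function harmonic off `x` with zero boundary value.
  set F : ℕ → ℝ≥0∞ := fun z => if z = x then 0 else escapeProb (walkKernel p) x z with hF
  have hF1 : ∀ z, F z ≤ 1 := by
    intro z
    simp only [hF]
    split_ifs
    · exact zero_le_one
    · exact prob_le_one
  have hFtop : ∀ z, F z ≠ ∞ := fun z => ((hF1 z).trans_lt ENNReal.one_lt_top).ne
  have hFx : F x = 0 := by simp [hF]
  have hstep : ∀ y, y ≠ x → F y = ∫⁻ z, F z ∂(walkKernel p y) := by
    intro y hy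
    rw [← escapeProb_eq_lintegral]; simp [hF, hy]
  have hreal : ∀ m, m + 1 ≠ x → (F (m + 1)).toReal
      = p m.succPNat * (F m).toReal + (1 - p m.succPNat) * (F (m + 2)).toReal := by
    intro m hm
    rw [hstep _ hm, lintegral_walkKernel_succ, ENNReal.toReal_add
      (ENNReal.mul_ne_top ENNReal.ofReal_ne_top (hFtop _))
      (ENNReal.mul_ne_top ENNReal.ofReal_ne_top (hFtop _)), ENNReal.toReal_mul, ENNReal.toReal_mul,
      ENNReal.toReal_ofReal (hp _).1.le, ENNReal.toReal_ofReal (by linarith [hp m.succPNat])]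
  have hzero : 0 < x → (F 0).toReal = (F 1).toReal := by
    intro hx
    have h := congrArg ENNReal.toReal (hstep 0 hx.ne)
    rw [lintegral_walkKernel_zero, ENNReal.toReal_add
      (ENNReal.mul_ne_top (by simp) (hFtop _)) (ENNReal.mul_ne_top (by simp) (hFtop _)),
      ENNReal.toReal_mul, ENNReal.toReal_mul] at h
    simp only [ENNReal.toReal_inv, ENNReal.toReal_ofNat] at h
    linarith
  have hall : ∀ z, F z = 0 := by
    intro z
    have : (F z).toReal = 0 := by
      rcases le_total x z with h | h
      · exact eq_zero_of_harmonic_above (a := fun m => (p m.succPNat : ℝ)) (fun m => hp _)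
          (fun m => Real.exp_pos _) (exp_potential_succ hp) (f := fun z => (F z).toReal)
          (fun m hm => hreal m (by omega)) (by simp [hFx]) (fun _ => ENNReal.toReal_nonneg)
          (fun m => ENNReal.toReal_mono ENNReal.one_ne_top (hF1 m)) (frequently_lt_exp htop) h
      · exact eq_zero_of_harmonic_below (a := fun m => (p m.succPNat : ℝ)) (fun m => hp _)
          (f := fun z => (F z).toReal) (fun m hm => hreal m (by omega)) hzero (by simp [hFx]) h
    exact ((ENNReal.toReal_eq_zero_iff _).1 this).resolve_right (hFtop z)
  rw [escapeProb_eq_lintegral]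
  change ∫⁻ z, F z ∂_ = 0
  simp [hall]

include hp in
theorem meanHitTime_self_eq_top (htop : ∀ C, ∃ᶠ m in atTop, C < potential p m)
    (hbot : ∀ C, ∃ᶠ m in atTop, C < -potential p m) (x : ℕ) :
    meanHitTime (walkKernel p) x x = ∞ := by
  by_contra hfin
  set F : ℕ → ℝ≥0∞ := fun z => if z = x then 0 else meanHitTime (walkKernel p) x z with hF
  have hFx : F x = 0 := by simp [hF]
  have heq : ∀ y, meanHitTime (walkKernel p) x y = 1 + ∫⁻ z, F z ∂(walkKernel p y) :=
    meanHitTime_eq_lintegral (walkKernel p) x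
  have hq : ∀ m : ℕ, ENNReal.ofReal (1 - p m.succPNat) ≠ 0 := fun m => by
    simpa using (hp m.succPNat).2
  -- Upward steps have positive probability, so finiteness at `x` spreads to all higher sites, where
  -- the real-valued equation can then be used.
  have hnext : ∀ y, meanHitTime (walkKernel p) x y ≠ ∞ → F (y + 1) ≠ ∞ := by
    intro y hy h
    refine hy ((heq y).trans ?_)
    rcases y with _ | m
    · rw [lintegral_walkKernel_zero]
      simp only [zero_add] at h
      simp [h]
    · rw [lintegral_walkKernel_succ, h, ENNReal.mul_top (hq m)]
      simp
  have hFtop : ∀ m, x ≤ m → F m ≠ ∞ := by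
    intro m hm
    induction m, hm using Nat.le_induction with
    | base => simp [hFx]
    | succ m hm ih =>
      refine hnext m ?_
      rcases eq_or_ne m x with rfl | hne
      · exact hfin
      · simpa [hF, hne] using ih
  have hreal : ∀ m, x ≤ m → (F (m + 1)).toReal
      = 1 + (p m.succPNat * (F m).toReal + (1 - p m.succPNat) * (F (m + 2)).toReal) := by
    intro m hm
    have h1 : F (m + 1) = 1 + ∫⁻ z, F z ∂(walkKernel p (m + 1)) := by
      rw [← heq]; simp [hF, show m + 1 ≠ x by omega]
    have h2 := ENNReal.mul_ne_top (ENNReal.ofReal_ne_top (r := p m.succPNat)) (hFtop m hm)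
    have h3 := ENNReal.mul_ne_top (ENNReal.ofReal_ne_top (r := 1 - p m.succPNat))
      (hFtop (m + 2) (by omega))
    rw [h1, lintegral_walkKernel_succ, ENNReal.toReal_add ENNReal.one_ne_top
      (ENNReal.add_ne_top.2 ⟨h2, h3⟩), ENNReal.toReal_add h2 h3, ENNReal.toReal_mul,
      ENNReal.toReal_mul, ENNReal.toReal_ofReal (hp _).1.le,
      ENNReal.toReal_ofReal (by linarith [hp m.succPNat]), ENNReal.toReal_one]
  obtain ⟨m, hm⟩ := exists_neg_of_mean_hitting_equation (a := fun m => (p m.succPNat : ℝ))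
    (fun m => hp _) (fun m => Real.exp_pos _) (exp_potential_succ hp)
    (f := fun z => (F z).toReal) hreal (frequently_lt_exp htop)
    (by simpa only [Real.exp_neg] using frequently_lt_exp hbot)
  exact absurd ENNReal.toReal_nonneg (not_le.2 hm)

include hp in
theorem isNullRecurrent_walkKernel (htop : ∀ C, ∃ᶠ m in atTop, C < potential p m)
    (hbot : ∀ C, ∃ᶠ m in atTop, C < -potential p m) : IsNullRecurrent (walkKernel p) :=
  fun x => ⟨isRecurrentState_walkKernel hp htop x, meanHitTime_self_eq_top hp htop hbot x⟩

end FixedEnvironment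

/-! ### Oscillation of sums of independent bounded centred random variables -/

theorem frequently_lt_of_not_bddAbove {u : ℕ → ℝ} (h : ¬ BddAbove (Set.range u)) (C : ℝ) :
    ∃ᶠ n in atTop, C < u n := by
  by_contra hC
  rw [not_frequently] at hC
  exact h (IsBoundedUnder.bddAbove_range ⟨C, eventually_map.2 (hC.mono fun n hn => not_lt.1 hn)⟩)

variable {Ω : Type*} [MeasurableSpace Ω] {μ : Measure Ω}

theorem martingale_sum_of_iIndepFun {D : ℕ → Ω → ℝ} (hm : ∀ n, StronglyMeasurable (D n))
    (hind : iIndepFun D μ) (hint : ∀ n, Integrable (D n) μ) (hmean : ∀ n, ∫ ω, D n ω ∂μ = 0) :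
    Martingale (fun n => ∑ i ∈ Finset.range (n + 1), D i) (Filtration.natural D hm) μ := by
  have : IsProbabilityMeasure μ := hind.isProbabilityMeasure
  refine martingale_of_condExp_sub_eq_zero_nat (fun n => ?_) (fun n => ?_) (fun n => ?_)
  · refine Finset.stronglyMeasurable_sum _ fun i hi => ?_
    exact (Filtration.stronglyAdapted_natural hm i).mono
      ((Filtration.natural D hm).mono (Nat.lt_succ_iff.1 (Finset.mem_range.1 hi)))
  · exact integrable_finsetSum' _ fun i _ => hint i
  · have h1 : ∑ i ∈ Finset.range (n + 1 + 1), D i - ∑ i ∈ Finset.range (n + 1), D i = D (n + 1) := by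
      rw [Finset.sum_range_succ, add_sub_cancel_left]
    simp only [h1]
    refine (hind.condExp_natural_ae_eq_of_lt hm (Nat.lt_succ_self n)).trans ?_
    rw [hmean]; rfl

theorem ae_frequently_lt_sum {D : ℕ → Ω → ℝ} (hm : ∀ n, Measurable (D n))
    (hind : iIndepFun D μ) {R : ℝ≥0} (hbdd : ∀ n ω, |D n ω| ≤ R)
    (hmean : ∀ n, ∫ ω, D n ω ∂μ = 0) (hnot : ∀ᵐ ω ∂μ, ¬ Tendsto (fun n => D n ω) atTop (𝓝 0)) :
    ∀ᵐ ω ∂μ, (∀ C, ∃ᶠ n in atTop, C < ∑ i ∈ Finset.range n, D i ω) ∧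
      ∀ C, ∃ᶠ n in atTop, C < -∑ i ∈ Finset.range n, D i ω := by
  have : IsProbabilityMeasure μ := hind.isProbabilityMeasure
  have hint : ∀ n, Integrable (D n) μ := fun n =>
    Integrable.of_bound (hm n).aestronglyMeasurable (R : ℝ) (.of_forall fun ω => hbdd n ω)
  have hM := martingale_sum_of_iIndepFun (fun n => (hm n).stronglyMeasurable) hind hint hmean
  have hinc : ∀ᵐ ω ∂μ, ∀ n, |(∑ i ∈ Finset.range (n + 1 + 1), D i) ω
      - (∑ i ∈ Finset.range (n + 1), D i) ω| ≤ R := .of_forall fun ω n => by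
    rw [Finset.sum_range_succ _ (n + 1), Pi.add_apply, add_sub_cancel_left]
    exact hbdd _ ω
  filter_upwards [hM.submartingale.bddAbove_iff_exists_tendsto hinc,
    hM.bddAbove_range_iff_bddBelow_range hinc, hnot] with ω h1 h2 h3
  simp only [Finset.sum_apply] at h1 h2
  have hA : ¬ BddAbove (Set.range fun n => ∑ i ∈ Finset.range (n + 1), D i ω) := by
    rw [h1]
    rintro ⟨c, hc⟩
    -- Convergence of the sums would force the increments to zero.
    refine h3 ((tendsto_add_atTop_iff_nat 1).1 ?_)
    have := ((tendsto_add_atTop_iff_nat 1).2 hc).sub hc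
    simpa [Finset.sum_range_succ _ (_ + 1)] using this
  have hB : ¬ BddAbove (Set.range fun n => -∑ i ∈ Finset.range (n + 1), D i ω) := by
    rintro ⟨c, hc⟩
    refine hA (h2.2 ⟨-c, ?_⟩)
    rintro _ ⟨n, rfl⟩
    have : -∑ i ∈ Finset.range (n + 1), D i ω ≤ c := hc ⟨n, rfl⟩
    exact neg_le.1 this
  exact ⟨fun C => (tendsto_add_atTop_nat 1).frequently (frequently_lt_of_not_bddAbove hA C),
    fun C => (tendsto_add_atTop_nat 1).frequently (frequently_lt_of_not_bddAbove hB C)⟩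

/-- The second Borel–Cantelli lemma. -/
theorem ae_frequently_mem_of_iid {β : Type*} [MeasurableSpace β] {V : ℕ → Ω → β}
    (hm : ∀ n, Measurable (V n)) (hind : iIndepFun V μ) {T : Set β} (hT : MeasurableSet T)
    {c : ℝ≥0∞} (hc : c ≠ 0) (hV : ∀ n, μ (V n ⁻¹' T) = c) :
    ∀ᵐ ω ∂μ, ∃ᶠ n in atTop, V n ω ∈ T := by
  have : IsProbabilityMeasure μ := hind.isProbabilityMeasure
  have hs : ∀ n, MeasurableSet (V n ⁻¹' T) := fun n => hm n hT
  have hsind : iIndepSet (fun n => V n ⁻¹' T) μ :=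
    (iIndepSet_iff_meas_biInter hs).2 fun S => hind.meas_biInter fun i _ => ⟨T, hT, rfl⟩
  have h1 := measure_limsup_eq_one hs hsind
    (by simp only [hV]; exact ENNReal.tsum_const_eq_top_of_ne_zero hc)
  have h2 : ∀ᵐ ω ∂μ, ω ∈ limsup (fun n => V n ⁻¹' T) atTop :=
    (prob_compl_eq_zero_iff (.measurableSet_limsup hs)).2 h1
  filter_upwards [h2] with ω hω
  exact Filter.mem_limsup_iff_frequently_mem.1 hω

theorem exists_measure_le_abs_ne_zero {Z : Ω → ℝ} (hZ : ¬ Z =ᵐ[μ] 0) :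
    ∃ δ > 0, μ {ω | δ ≤ |Z ω|} ≠ 0 := by
  by_contra! h
  refine hZ ?_
  have h1 : ∀ᵐ ω ∂μ, ∀ k : ℕ, |Z ω| < 1 / ((k : ℝ) + 1) := by
    refine ae_all_iff.2 fun k => ?_
    rw [ae_iff]
    simpa using h (1 / ((k : ℝ) + 1)) Nat.one_div_pos_of_nat
  filter_upwards [h1] with ω hω
  by_contra hne
  obtain ⟨k, hk⟩ := exists_nat_one_div_lt (abs_pos.2 hne)
  exact absurd hk (not_lt.2 (hω k).le)

/-! ### The logarithmic odds of the truncated perturbation -/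

theorem measurable_truncate (ε : ℝ) : Measurable (truncate ε) := by
  unfold truncate
  exact Measurable.ite measurableSet_Iio measurable_const
    (Measurable.ite measurableSet_Ioi measurable_const measurable_id)

theorem truncate_mem_Icc {ε : ℝ} (hε : 0 < ε ∧ ε < 1 / 2) (x : ℝ) :
    ε / 2 ≤ truncate ε x ∧ truncate ε x ≤ 1 - ε / 2 := by
  unfold truncate
  split_ifs <;> constructor <;> linarith [hε.1, hε.2]

/-- Since `x` lies inside the truncation interval, truncating can only move `x + s` closer to `x`.
-/
theorem abs_truncate_add_sub_le {ε x s : ℝ} (hε : 0 < ε) (hx : ε ≤ x ∧ x ≤ 1 - ε) :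
    |truncate ε (x + s) - x| ≤ |s| := by
  unfold truncate
  split_ifs
  · rw [abs_le]; constructor <;> linarith [neg_abs_le s, abs_nonneg s]
  · rw [abs_le]; constructor <;> linarith [le_abs_self s, abs_nonneg s]
  · simp

theorem abs_log_sub_log_le {c x y : ℝ} (hc : 0 < c) (hx : c ≤ x) (hy : c ≤ y) :
    |Real.log x - Real.log y| ≤ |x - y| / c := by
  have key : ∀ {u v : ℝ}, c ≤ u → c ≤ v → Real.log u - Real.log v ≤ |u - v| / c := by
    intro u v hu hv
    have hu0 := hc.trans_le hu
    have hv0 := hc.trans_le hv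
    rw [← Real.log_div hu0.ne' hv0.ne']
    calc Real.log (u / v) ≤ u / v - 1 := Real.log_le_sub_one_of_pos (div_pos hu0 hv0)
      _ = (u - v) / v := by field_simp
      _ ≤ |u - v| / v := div_le_div_of_nonneg_right (le_abs_self _) hv0.le
      _ ≤ |u - v| / c := div_le_div_of_nonneg_left (abs_nonneg _) hc hv
  rw [abs_le]
  refine ⟨?_, key hx hy⟩
  have := key hy hx
  rw [abs_sub_comm] at this
  linarith

/-- The logarithm of the odds ratio `x / (1 - x)`. -/
noncomputable def logOdds (x : ℝ) : ℝ := Real.log (x / (1 - x))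

theorem measurable_logOdds : Measurable logOdds := by
  unfold logOdds; fun_prop

theorem abs_logOdds_sub_le {c x y : ℝ} (hc : 0 < c) (hx : c ≤ x ∧ x ≤ 1 - c)
    (hy : c ≤ y ∧ y ≤ 1 - c) : |logOdds x - logOdds y| ≤ 2 * |x - y| / c := by
  unfold logOdds
  rw [Real.log_div (by linarith) (by linarith), Real.log_div (by linarith) (by linarith)]
  have h1 := abs_log_sub_log_le hc hx.1 hy.1
  have h2 := abs_log_sub_log_le hc (x := 1 - x) (y := 1 - y) (by linarith) (by linarith)
  rw [show 1 - x - (1 - y) = -(x - y) by ring, abs_neg] at h2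
  rw [abs_le] at *
  rw [mul_div_assoc]
  constructor <;> linarith

theorem integral_logOdds_truncate_eq_zero [IsProbabilityMeasure μ] {ε s : ℝ}
    (hε : 0 < ε ∧ ε < 1 / 2) (hs : 0 ≤ s ∧ s ≤ ε / 2) {X Y : Ω → ℝ} (hXm : Measurable X)
    (hYm : Measurable Y) (hX : ∀ᵐ ω ∂μ, ε ≤ X ω ∧ X ω ≤ 1 - ε) (hY : ∀ ω, -1 ≤ Y ω ∧ Y ω ≤ 1)
    (hsymm : IdentDistrib (fun ω => Y ω / X ω) (fun ω => -Y ω / (1 - X ω)) μ μ)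
    (hmean : ∫ ω, logOdds (X ω) ∂μ = 0) :
    ∫ ω, logOdds (truncate ε (X ω + Y ω * s)) ∂μ = 0 := by
  have hε2 : 0 < ε / 2 := half_pos hε.1
  have hYs : ∀ ω, |Y ω * s| ≤ ε / 2 := fun ω => by
    rw [abs_mul, abs_of_nonneg hs.1]
    nlinarith [abs_le.2 (hY ω), abs_nonneg (Y ω)]
  set L : ℝ → ℝ := fun t => Real.log (1 + s * t) with hL
  have hLm : Measurable L := by fun_prop
  have hdecomp : ∀ᵐ ω ∂μ, logOdds (truncate ε (X ω + Y ω * s))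
      = logOdds (X ω) + L (Y ω / X ω) - L (-Y ω / (1 - X ω)) := by
    filter_upwards [hX] with ω hω
    have hb := abs_le.1 (hYs ω)
    have htr : truncate ε (X ω + Y ω * s) = X ω + Y ω * s := by
      unfold truncate
      rw [if_neg (by linarith), if_neg (by linarith)]
    have h1 : 0 < X ω := by linarith
    have h2 : 0 < 1 - X ω := by linarith
    have h3 : 0 < X ω + Y ω * s := by linarith
    have h4 : 0 < 1 - (X ω + Y ω * s) := by linarith
    have e1 : 1 + s * (Y ω / X ω) = (X ω + Y ω * s) / X ω := by field_simp
    have e2 : 1 + s * (-Y ω / (1 - X ω)) = (1 - (X ω + Y ω * s)) / (1 - X ω) := by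
      field_simp; ring
    rw [htr, hL]
    simp only [logOdds]
    rw [e1, e2, Real.log_div h3.ne' h4.ne', Real.log_div h3.ne' h1.ne', Real.log_div h4.ne' h2.ne',
      Real.log_div h1.ne' h2.ne']
    ring
  have hint0 : Integrable (fun ω => logOdds (X ω)) μ := by
    refine Integrable.of_bound (measurable_logOdds.comp hXm).aestronglyMeasurable
      (2 * 1 / ε + |logOdds (1 / 2)|) ?_
    filter_upwards [hX] with ω hω
    have h := abs_logOdds_sub_le hε.1 hω (y := 1 / 2) ⟨by linarith, by linarith⟩
    have h' : 2 * |X ω - 1 / 2| / ε ≤ 2 * 1 / ε := by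
      gcongr
      · exact hε.1.le
      · rw [abs_le]; constructor <;> linarith
    rw [Real.norm_eq_abs]
    have := abs_sub_abs_le_abs_sub (logOdds (X ω)) (logOdds (1 / 2))
    linarith
  have hint1 : Integrable (fun ω => L (Y ω / X ω)) μ := by
    refine Integrable.of_bound (hLm.comp (hYm.div hXm)).aestronglyMeasurable 1 ?_
    filter_upwards [hX] with ω hω
    have hb := abs_le.1 (hYs ω)
    have h1 : 0 < X ω := by linarith
    have h3 : 0 < X ω + Y ω * s := by linarith
    have e1 : 1 + s * (Y ω / X ω) = (X ω + Y ω * s) / X ω := by field_simp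
    rw [Real.norm_eq_abs, hL]
    simp only
    rw [e1, Real.log_div h3.ne' h1.ne']
    refine (abs_log_sub_log_le hε2 (by linarith) (by linarith)).trans ?_
    rw [add_sub_cancel_left, div_le_one hε2]
    exact hYs ω
  -- Equality in law supplies both the integrability of the last term and its cancellation in the
  -- mean.
  have hLsymm := hsymm.comp hLm
  have hint2 : Integrable (fun ω => L (-Y ω / (1 - X ω))) μ := hLsymm.integrable_iff.1 hint1
  have hLint : ∫ ω, L (Y ω / X ω) ∂μ = ∫ ω, L (-Y ω / (1 - X ω)) ∂μ := hLsymm.integral_eq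
  have hsub := integral_sub (hint0.add hint1) hint2
  simp only [Pi.add_apply] at hsub
  rw [integral_congr_ae hdecomp, hsub, integral_add hint0 hint1, hmean, hLint]
  ring

end PerturbedRWRE

open PerturbedRWRE in
theorem mainTheorem3
    {Ω : Type*} [MeasurableSpace Ω] (μ : Measure Ω) [IsProbabilityMeasure μ]
    (ξ Y : ℕ+ → Ω → ℝ)
    (hξ_meas : ∀ i, Measurable (ξ i)) (hY_meas : ∀ i, Measurable (Y i))
    -- the pairs `(ξ i, Y i)` are i.i.d.
    (h_indep : iIndepFun (fun i ω => (ξ i ω, Y i ω)) μ)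
    (h_ident : ∀ i, IdentDistrib (fun ω => (ξ i ω, Y i ω)) (fun ω => (ξ 1 ω, Y 1 ω)) μ μ)
    -- uniform ellipticity, and boundedness of the perturbation variables
    (ε : ℝ) (hε : 0 < ε ∧ ε < 1 / 2)
    (hξ : ∀ᵐ ω ∂μ, ε ≤ ξ 1 ω ∧ ξ 1 ω ≤ 1 - ε)
    (hY : ∀ i ω, -1 ≤ Y i ω ∧ Y i ω ≤ 1)
    -- `Y₁ / ξ₁` and `-Y₁ / (1 - ξ₁)` have the same distribution
    (h_symm : IdentDistrib (fun ω => Y 1 ω / ξ 1 ω) (fun ω => -Y 1 ω / (1 - ξ 1 ω)) μ μ)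
    (hY_ne : μ {ω | Y 1 ω = 0} < 1)
    -- `ζ₁ = log (ξ₁ / (1 - ξ₁))` has mean zero and positive variance
    (h_mean : ∫ ω, Real.log (ξ 1 ω / (1 - ξ 1 ω)) ∂μ = 0)
    (h_var : 0 < variance (fun ω => Real.log (ξ 1 ω / (1 - ξ 1 ω))) μ)
    (χ : ℝ≥0 → ℝ≥0) (hχ : Tendsto χ atTop (𝓝 0)) :
    ∀ᵐ ω ∂μ, PerturbedRWRE.IsNullRecurrent (PerturbedRWRE.walkKernel
      (PerturbedRWRE.environment hε χ (fun n => ξ n ω) (fun n => Y n ω))) := by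
  have hε2 : 0 < ε / 2 := half_pos hε.1
  set s : ℕ → ℝ := fun n => (χ ((n.succPNat : ℕ) : ℝ≥0) : ℝ) with hs
  have hs0 : ∀ n, 0 ≤ s n := fun n => NNReal.coe_nonneg _
  have hstend : Tendsto s atTop (𝓝 0) := by
    have h1 : Tendsto (fun n : ℕ => ((n.succPNat : ℕ) : ℝ≥0)) atTop atTop :=
      tendsto_natCast_atTop_atTop.comp (tendsto_add_atTop_nat 1)
    simpa [hs] using NNReal.tendsto_coe.2 (hχ.comp h1)
  set φ : ℕ → ℝ × ℝ → ℝ := fun n v => logOdds (truncate ε (v.1 + v.2 * s n)) with hφ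
  have hφm : ∀ n, Measurable (φ n) := fun n =>
    measurable_logOdds.comp ((measurable_truncate ε).comp (by fun_prop))
  set V : ℕ → Ω → ℝ × ℝ := fun n ω => (ξ n.succPNat ω, Y n.succPNat ω) with hV
  have hVm : ∀ n, Measurable (V n) := fun n => (hξ_meas _).prodMk (hY_meas _)
  have hVind : iIndepFun V μ := h_indep.precomp Nat.succPNat_injective
  have hVident : ∀ n, IdentDistrib (V n) (fun ω => (ξ 1 ω, Y 1 ω)) μ μ := fun n => h_ident _
  set Z : ℕ → Ω → ℝ := fun n ω => φ n (V n ω) with hZ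
  have hZm : ∀ n, Measurable (Z n) := fun n => (hφm n).comp (hVm n)
  set c : ℕ → ℝ := fun n => ∫ ω, Z n ω ∂μ with hc
  have hc0 : ∀ᶠ n in atTop, c n = 0 := by
    filter_upwards [hstend.eventually (ge_mem_nhds hε2)] with n hn
    have h1 : c n = ∫ ω, φ n (ξ 1 ω, Y 1 ω) ∂μ := ((hVident n).comp (hφm n)).integral_eq
    rw [h1]
    exact integral_logOdds_truncate_eq_zero hε ⟨hs0 n, hn⟩ (hξ_meas 1) (hY_meas 1) hξ (hY 1)
      h_symm h_mean
  -- The Lipschitz bound for `logOdds` on `[ε/2, 1 - ε/2]`, compared with the point `1/2`.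
  set B : ℝ := 2 / (ε / 2) + |logOdds (1 / 2)| with hB
  have hZbdd : ∀ n ω, |Z n ω| ≤ B := by
    intro n ω
    have h1 := truncate_mem_Icc hε ((V n ω).1 + (V n ω).2 * s n)
    have h2 := abs_logOdds_sub_le hε2 h1 (y := 1 / 2) ⟨by linarith, by linarith⟩
    have h3 : 2 * |truncate ε ((V n ω).1 + (V n ω).2 * s n) - 1 / 2| / (ε / 2) ≤ 2 / (ε / 2) := by
      refine div_le_div_of_nonneg_right ?_ hε2.le
      have : |truncate ε ((V n ω).1 + (V n ω).2 * s n) - 1 / 2| ≤ 1 := by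
        rw [abs_le]; constructor <;> linarith
      linarith
    have h4 := abs_sub_abs_le_abs_sub (Z n ω) (logOdds (1 / 2))
    exact (sub_le_iff_le_add.1 (h4.trans (h2.trans h3)))
  have hB0 : 0 ≤ B := by positivity
  have hcbdd : ∀ n, |c n| ≤ B := fun n => by
    simpa using norm_integral_le_of_norm_le_const (μ := μ) (f := Z n) (C := B)
      (.of_forall fun ω => hZbdd n ω)
  have hZint : ∀ n, Integrable (Z n) μ := fun n =>
    Integrable.of_bound (hZm n).aestronglyMeasurable B (.of_forall fun ω => hZbdd n ω)
  have hDind : iIndepFun (fun n ω => Z n ω - c n) μ :=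
    hVind.comp (fun n v => φ n v - c n) fun n => (hφm n).sub_const _
  have hξall : ∀ᵐ ω ∂μ, ∀ n, ε ≤ (V n ω).1 ∧ (V n ω).1 ≤ 1 - ε := by
    refine ae_all_iff.2 fun n => ?_
    exact ((hVident n).symm.comp measurable_fst).ae_mem_snd measurableSet_Icc hξ
  have hclose : ∀ᵐ ω ∂μ, Tendsto (fun n => Z n ω - logOdds (V n ω).1) atTop (𝓝 0) := by
    filter_upwards [hξall] with ω hω
    refine squeeze_zero_norm (a := fun n => 2 * s n / (ε / 2)) (fun n => ?_) ?_
    · refine (abs_logOdds_sub_le hε2 (truncate_mem_Icc hε _)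
        ⟨by linarith [hω n], by linarith [hω n]⟩).trans ?_
      refine div_le_div_of_nonneg_right ?_ hε2.le
      have h1 := abs_truncate_add_sub_le (s := (V n ω).2 * s n) hε.1 (hω n)
      have h2 : |(V n ω).2 * s n| ≤ s n := by
        rw [abs_mul, abs_of_nonneg (hs0 n)]
        exact mul_le_of_le_one_left (hs0 n) (abs_le.2 (hY _ ω))
      linarith
    · simpa using (hstend.const_mul 2).div_const (ε / 2)
  -- Positive variance prevents `ζ₁` from vanishing almost surely, so `|ζ_n| ≥ δ` infinitely often.
  obtain ⟨δ, hδ, hδμ⟩ := exists_measure_le_abs_ne_zero (μ := μ) (Z := fun ω => logOdds (ξ 1 ω))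
    fun h => h_var.ne' ((variance_congr h).trans (variance_zero μ))
  have hT : MeasurableSet {v : ℝ × ℝ | δ ≤ |logOdds v.1|} :=
    measurableSet_le measurable_const (measurable_logOdds.comp measurable_fst).abs
  have hfreq := ae_frequently_mem_of_iid hVm hVind hT hδμ fun n => (hVident n).measure_mem_eq hT
  have hnot : ∀ᵐ ω ∂μ, ¬ Tendsto (fun n => Z n ω - c n) atTop (𝓝 0) := by
    filter_upwards [hclose, hfreq] with ω h1 h2 h3
    have h4 : Tendsto (fun n => logOdds (V n ω).1) atTop (𝓝 0) := by
      have h5 := h3.sub h1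
      rw [sub_zero] at h5
      refine h5.congr' ?_
      filter_upwards [hc0] with n hn
      rw [hn]; ring
    have h6 : ∀ᶠ n in atTop, |logOdds (V n ω).1| < δ := by
      have := h4.abs
      rw [abs_zero] at this
      exact this.eventually (gt_mem_nhds hδ)
    obtain ⟨n, hn, hn'⟩ := (h2.and_eventually h6).exists
    exact absurd hn (not_le.2 hn')
  -- Only finitely many means are nonzero, so centring shifts the potential by a bounded amount.
  obtain ⟨K, hK⟩ : ∃ K, ∀ n, |∑ i ∈ Finset.range n, c i| ≤ K := by
    obtain ⟨N, hN⟩ := eventually_atTop.1 hc0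
    have hfin : (Function.support c).Finite := (Set.finite_lt_nat N).subset fun n hn => by
      by_contra h
      exact hn (hN n (not_lt.1 h))
    have := (summable_of_hasFiniteSupport hfin).hasSum.tendsto_sum_nat.abs.bddAbove_range
    exact ⟨_, fun n => this.choose_spec ⟨n, rfl⟩⟩
  have hmain := ae_frequently_lt_sum (R := (2 * B).toNNReal) (D := fun n ω => Z n ω - c n)
    (fun n => (hZm n).sub_const _) hDind
    (fun n ω => by
      rw [Real.coe_toNNReal _ (by positivity)]
      linarith [abs_sub (Z n ω) (c n), hZbdd n ω, hcbdd n])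
    (fun n => by rw [integral_sub (hZint n) (integrable_const _)]; simp [hc]) hnot
  filter_upwards [hmain] with ω hω
  have hpot : ∀ n, potential (environment hε χ (fun n => ξ n ω) (fun n => Y n ω)) n
      = ∑ i ∈ Finset.range n, (Z i ω - c i) + ∑ i ∈ Finset.range n, c i := fun n => by
    rw [← Finset.sum_add_distrib]
    simp only [sub_add_cancel]
    rfl
  refine isNullRecurrent_walkKernel (fun n => ?_) (fun C => ?_) (fun C => ?_)
  · have := truncate_mem_Icc hε (ξ n ω + Y n ω * (χ (n : ℕ) : ℝ))
    exact ⟨hε2.trans_le this.1, this.2.trans_lt (by linarith)⟩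
  · refine (hω.1 (C + K)).mono fun n hn => ?_
    rw [hpot]
    linarith [(abs_le.1 (hK n)).1]
  · refine (hω.2 (C + K)).mono fun n hn => ?_
    rw [hpot]
    linarith [(abs_le.1 (hK n)).2]
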